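/- Let $F$ be an algebraically closed field and $A_0$ a field extension of $F$. Let $A$ be a quantum formal deformation of $A_0$ over $F[[\hbar]]$, i.e. an associative unital (not necessarily commutative) $F[[\hbar]]$-algebra which is isomorphic to $A_0[[\hbar]]$ as an $F[[\hbar]]$-module and is equipped with an isomorphism of $F$-algebras $A/(\hbar)\cong A_0$. Suppose that $A$ is a PI algebra of degree $d$, i.e. $A$ satisfies a nonzero polynomial identity over $F$, and it satisfies all polynomial identities of the algebra $\mathrm{Mat}_d(F)$ of $d\times d$ matrices, but not all identities of $\mathrm{Mat}_e(F)$ for any $e<d$. (i) If $\mathrm{char}\,F=0$, then $d=1$ (and $A$ is commutative). (ii) If $\mathrm{char}\,F=p>0$, then $d$ is a power of $p$ (that is, $d=p^k$ for some integer $k\ge 0$). -/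

import Mathlib

open scoped PowerSeries

/-- The ideal `(ħ) = Aħ` of an algebra `A` over `F⟦ħ⟧`. It is two-sided because the image of `ħ`
in `A` is central. -/
def hbarIdeal (F A : Type*) [Field F] [Ring A] [Algebra F⟦X⟧ A] : Ideal A :=
  Ideal.span {algebraMap F⟦X⟧ A PowerSeries.X}

instance hbarIdeal_isTwoSided (F A : Type*) [Field F] [Ring A] [Algebra F⟦X⟧ A] :
    (hbarIdeal F A).IsTwoSided := by
  refine ⟨fun {a} b ha => ?_⟩
  obtain ⟨c, rfl⟩ := Ideal.mem_span_singleton'.1 ha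
  refine Ideal.mem_span_singleton'.2 ⟨c * b, ?_⟩
  rw [mul_assoc, mul_assoc, Algebra.commutes]

/-- `A` is a quantum formal deformation of the `F`-algebra `A₀` over `F⟦ħ⟧`: an associative unital
(possibly noncommutative) `F⟦ħ⟧`-algebra, isomorphic to `A₀⟦ħ⟧` as an `F⟦ħ⟧`-module, and equipped
with an isomorphism of algebras `A / (ħ) ≅ A₀` over `F = F⟦ħ⟧ / (ħ)`. -/
structure QuantumFormalDeformation (F A₀ A : Type*) [Field F] [CommRing A₀] [Algebra F A₀]
    [Ring A] [Algebra F⟦X⟧ A] [Algebra F A] [IsScalarTower F F⟦X⟧ A] where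
  /-- `A ≅ A₀⟦ħ⟧` as modules over `F⟦ħ⟧`. -/
  moduleIso : Nonempty (A ≃ₗ[F⟦X⟧] A₀⟦X⟧)
  /-- `A / (ħ) ≅ A₀` as algebras. -/
  reductionIso : (A ⧸ hbarIdeal F A) ≃ₐ[F] A₀

/-- The noncommutative polynomial `f` with coefficients in `F` is a polynomial identity of the
`F`-algebra `A`: it vanishes under all substitutions of elements of `A` for the variables. -/
def IsPolynomialIdentity (F A : Type*) [Field F] [Ring A] [Algebra F A]
    (f : FreeAlgebra F ℕ) : Prop :=
  ∀ a : ℕ → A, FreeAlgebra.lift F a f = 0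

/-- `A` satisfies a nonzero polynomial identity over `F`. -/
def IsPIAlgebra (F A : Type*) [Field F] [Ring A] [Algebra F A] : Prop :=
  ∃ f : FreeAlgebra F ℕ, f ≠ 0 ∧ IsPolynomialIdentity F A f

/-- `A` satisfies all polynomial identities of the algebra of `n × n` matrices over `F`. -/
def SatisfiesMatrixIdentities (F A : Type*) [Field F] [Ring A] [Algebra F A] (n : ℕ) : Prop :=
  ∀ f : FreeAlgebra F ℕ, IsPolynomialIdentity F (Matrix (Fin n) (Fin n) F) f →
    IsPolynomialIdentity F A f

/-- `A` is a PI algebra of degree `d`: it is a PI algebra which satisfies the identities of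
matrices of size `d × d`, but not those of matrices of any smaller size. -/
structure IsPIAlgebraOfDegree (F A : Type*) [Field F] [Ring A] [Algebra F A] (d : ℕ) : Prop where
  isPI : IsPIAlgebra F A
  satisfies : SatisfiesMatrixIdentities F A d
  not_smaller : ∀ e < d, ¬ SatisfiesMatrixIdentities F A e

/-! Let `Z` be the center of `A`, `k` its image in `A₀`, and `r` the degree of `A₀` over `k`. The
proof shows that `A₀` is purely inseparable over `k` and that `r = d ^ 2`. Then `d ^ 2` is a power
of the exponential characteristic.

Pure inseparability is Hensel's lemma. Commutators lie in `hA`, so Newton iteration works for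
polynomials over `Z` despite noncommutativity. An element separable over `k` lifts uniquely to a
root in `A`. Conjugation by units preserves both the polynomial and the residue, hence fixes the
root; nonzero elements are powers of `h` times units, so the root is central
(`mem_residueCenter_of_isSeparable`).

For `r ≤ d ^ 2`, lifts of `k`-independent elements are `Z`-independent, and a Capelli polynomial can
be made nonzero on `Z`-independent elements; but the Capelli polynomials in more than `d ^ 2`
alternating variables are identities of `d × d` matrices (`finite_residueCenter`). For `d ^ 2 ≤ r`,
`A` is free of rank `r` over `Z` and embeds in `n × n` matrices over a field with `n ^ 2 ≤ r`
(`exists_injective_algHom_matrix`), while minimality of `d` gives `d ≤ n`. -/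

/-- `A` is a ring which is separated and complete in the `h`-adic topology for a central
non-zero-divisor `h`, and `π` identifies `A / hA` with the field `A₀`. -/
structure IsFormalDeformation {A A₀ : Type*} [Ring A] [Field A₀] (h : A) (π : A →+* A₀) :
    Prop where
  comm : ∀ a, Commute h a
  surj : Function.Surjective π
  map_eq_zero_iff : ∀ a, π a = 0 ↔ h ∣ a
  regular : ∀ a, h * a = 0 → a = 0
  separated : ∀ a, (∀ n, h ^ n ∣ a) → a = 0
  complete : ∀ a : ℕ → A, ∃ s, ∀ n, h ^ n ∣ s - ∑ k ∈ Finset.range n, h ^ k * a k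

/-- An algebra is an algebra over its center. -/
instance Subalgebra.centerAlgebra (F A : Type*) [CommSemiring F] [Semiring A] [Algebra F A] :
    Algebra (Subalgebra.center F A) A where
  smul c a := c • a
  algebraMap := (Subalgebra.center F A).val.toRingHom
  commutes' c a := (Subalgebra.mem_center_iff.1 c.2 a).symm
  smul_def' _ _ := rfl

/-! ### Units and the `h`-adic valuation -/

namespace IsFormalDeformation

section Ring

variable {A A₀ : Type*} [Ring A] [Field A₀] {h : A} {π : A →+* A₀}

theorem pow_comm (H : IsFormalDeformation h π) (n : ℕ) (a : A) : h ^ n * a = a * h ^ n :=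
  ((H.comm a).pow_left n).eq

theorem map_self (H : IsFormalDeformation h π) : π h = 0 :=
  (H.map_eq_zero_iff h).2 dvd_rfl

theorem nontrivial (H : IsFormalDeformation h π) : Nontrivial A :=
  H.surj.nontrivial

theorem pow_regular (H : IsFormalDeformation h π) (n : ℕ) {a : A} (ha : h ^ n * a = 0) :
    a = 0 := by
  induction n with
  | zero => simpa using ha
  | succ n ih => rw [pow_succ', mul_assoc] at ha; exact ih (H.regular _ ha)

theorem dvd_mul_left (H : IsFormalDeformation h π) {n : ℕ} {a : A} (b : A) (ha : h ^ n ∣ a) :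
    h ^ n ∣ b * a := by
  obtain ⟨c, rfl⟩ := ha
  exact ⟨b * c, by rw [← mul_assoc, ← H.pow_comm, mul_assoc]⟩

theorem dvd_of_pow_succ_dvd (H : IsFormalDeformation h π) {n : ℕ} {a : A}
    (ha : h ^ (n + 1) ∣ h ^ n * a) : h ∣ a := by
  obtain ⟨c, hc⟩ := ha
  refine ⟨c, ?_⟩
  rw [pow_succ, mul_assoc, ← sub_eq_zero, ← mul_sub] at hc
  exact sub_eq_zero.1 (H.pow_regular n hc)

theorem dvd_commutator (H : IsFormalDeformation h π) (a b : A) : h ∣ a * b - b * a := by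
  rw [← H.map_eq_zero_iff]; simp [mul_comm]

/-- The inverse is the geometric series in `h * c`, which converges by completeness. -/
theorem exists_inverse_one_sub (H : IsFormalDeformation h π) (c : A) :
    ∃ s, (1 - h * c) * s = 1 ∧ s * (1 - h * c) = 1 := by
  obtain ⟨s, hs⟩ := H.complete fun k => c ^ k
  have e : ∀ k, h ^ k * c ^ k = (h * c) ^ k := fun k => ((H.comm c).mul_pow k).symm
  simp only [e] at hs
  refine ⟨s, sub_eq_zero.1 (H.separated _ fun n => ?_), sub_eq_zero.1 (H.separated _ fun n => ?_)⟩
  · have h1 := mul_neg_geom_sum (h * c) n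
    have h2 : (1 - h * c) * s - 1 = (1 - h * c) * (s - ∑ k ∈ Finset.range n, (h * c) ^ k)
        - (h * c) ^ n := by rw [mul_sub, h1]; abel
    rw [h2]
    exact dvd_sub (H.dvd_mul_left _ (hs n)) (by rw [← e]; exact dvd_mul_right _ _)
  · have h1 := geom_sum_mul_neg (h * c) n
    have h2 : s * (1 - h * c) - 1 = (s - ∑ k ∈ Finset.range n, (h * c) ^ k) * (1 - h * c)
        - (h * c) ^ n := by rw [sub_mul, h1]; abel
    rw [h2]
    exact dvd_sub ((hs n).mul_right _) (by rw [← e]; exact dvd_mul_right _ _)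

theorem isUnit_of_map_eq_one (H : IsFormalDeformation h π) {a : A} (ha : π a = 1) : IsUnit a := by
  obtain ⟨c, hc⟩ := (H.map_eq_zero_iff (1 - a)).1 (by simp [ha])
  obtain ⟨s, h1, h2⟩ := H.exists_inverse_one_sub c
  rw [← hc, sub_sub_cancel] at h1 h2
  exact ⟨⟨a, s, h1, h2⟩, rfl⟩

theorem isUnit_of_map_ne_zero (H : IsFormalDeformation h π) {a : A} (ha : π a ≠ 0) :
    IsUnit a := by
  obtain ⟨b, hb⟩ := H.surj (π a)⁻¹
  obtain ⟨u, hu⟩ := H.isUnit_of_map_eq_one (a := a * b) (by simp [hb, ha])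
  obtain ⟨v, hv⟩ := H.isUnit_of_map_eq_one (a := b * a) (by simp [hb, ha])
  have h1 : a * (b * ↑u⁻¹) = 1 := by rw [← mul_assoc, ← hu, Units.mul_inv]
  have h2 : (↑v⁻¹ * b) * a = 1 := by rw [mul_assoc, ← hv, Units.inv_mul]
  exact ⟨⟨a, _, h1, by rwa [left_inv_eq_right_inv h2 h1] at h2⟩, rfl⟩

/-- Separatedness bounds the powers of `h` dividing `a`; once the largest is removed, the residue is
nonzero. So `A` behaves like a discrete valuation ring. -/
theorem exists_eq_pow_mul_unit (H : IsFormalDeformation h π) {a : A} (ha : a ≠ 0) :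
    ∃ (k : ℕ) (u : Aˣ), a = h ^ k * u := by
  classical
  have hex : ∃ n, ¬ h ^ n ∣ a := by
    by_contra! hn
    exact ha (H.separated a hn)
  have hpos : Nat.find hex ≠ 0 := fun h0 => by
    have := Nat.find_spec hex
    rw [h0, pow_zero] at this
    exact this (one_dvd a)
  obtain ⟨k, hk⟩ := Nat.exists_eq_succ_of_ne_zero hpos
  obtain ⟨b, hb⟩ := not_not.1 (Nat.find_min hex (m := k) (by omega))
  have hb' : π b ≠ 0 := fun h0 => by
    obtain ⟨c, rfl⟩ := (H.map_eq_zero_iff b).1 h0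
    apply Nat.find_spec hex
    rw [hk, hb, ← mul_assoc, ← pow_succ]
    exact dvd_mul_right _ _
  obtain ⟨u, rfl⟩ := H.isUnit_of_map_ne_zero hb'
  exact ⟨k, u, hb⟩

theorem eq_zero_or_eq_zero (H : IsFormalDeformation h π) {a b : A} (hab : a * b = 0) :
    a = 0 ∨ b = 0 := by
  rw [or_iff_not_imp_left]
  intro ha
  obtain ⟨k, u, rfl⟩ := H.exists_eq_pow_mul_unit ha
  rw [mul_assoc] at hab
  simpa using H.pow_regular k hab

theorem exists_mul_eq_pow (H : IsFormalDeformation h π) {a : A} (ha : a ≠ 0) :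
    ∃ (k : ℕ) (v : A), v * a = h ^ k ∧ a * v = h ^ k := by
  obtain ⟨k, u, rfl⟩ := H.exists_eq_pow_mul_unit ha
  refine ⟨k, ↑u⁻¹, ?_, by simp [mul_assoc]⟩
  rw [← mul_assoc, ← H.pow_comm, mul_assoc, Units.inv_mul, mul_one]

theorem pow_ne_zero (H : IsFormalDeformation h π) (n : ℕ) : h ^ n ≠ 0 := fun h0 => by
  have := H.nontrivial
  exact one_ne_zero (H.pow_regular n (a := 1) (by simpa using h0))

end Ring

/-! ### Hensel's lemma and the residue field of the center -/

section Algebra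

variable {F A A₀ : Type*} [Field F] [Ring A] [Algebra F A] [Field A₀] [Algebra F A₀]
  {h : A} {π : A →ₐ[F] A₀}

-- First-order Taylor expansion. The errors are commutators, which contribute an extra factor `h`,
-- and terms in `h ^ (2 * k)`, which is where `1 ≤ k` enters.
open Polynomial in
theorem pow_dvd_aeval_add_sub (H : IsFormalDeformation h π.toRingHom)
    (f : (Subalgebra.center F A)[X]) (x y : A) {k : ℕ} (hk : 1 ≤ k) :
    h ^ (k + 1) ∣ aeval (x + h ^ k * y) f - aeval x f - h ^ k * (aeval x (derivative f) * y) := by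
  have hstep : ∀ f : (Subalgebra.center F A)[X],
      h ^ (k + 1) ∣ aeval (x + h ^ k * y) f - aeval x f - h ^ k * (aeval x (derivative f) * y) →
      h ^ (k + 1) ∣ aeval (x + h ^ k * y) (f * X) - aeval x (f * X)
        - h ^ k * (aeval x (derivative (f * X)) * y) := by
    intro f hf
    simp only [map_mul, aeval_X, derivative_mul, derivative_X, mul_one, map_add]
    generalize aeval (x + h ^ k * y) f = p at *
    generalize aeval x f = q at *
    generalize aeval x (derivative f) = r at *
    obtain ⟨c, hc⟩ := H.dvd_commutator y x
    have e : p * (x + h ^ k * y) - q * x - h ^ k * ((r * x + q) * y) =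
        (p - q - h ^ k * (r * y)) * (x + h ^ k * y) + h ^ k * (r * (y * x - x * y))
          + h ^ k * (r * y * (h ^ k * y)) + (q * h ^ k - h ^ k * q) * y := by noncomm_ring
    rw [e, ← H.pow_comm k q, sub_self, zero_mul, add_zero]
    refine dvd_add (dvd_add (hf.mul_right _) ?_) ?_
    · rw [hc, pow_succ]
      refine mul_dvd_mul_left _ ⟨r * c, ?_⟩
      rw [← mul_assoc, ← mul_assoc, (H.comm r).eq]
    · rw [pow_succ]
      refine mul_dvd_mul_left _ ?_
      rw [← mul_assoc, ← H.pow_comm, mul_assoc]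
      exact (dvd_pow_self h (by omega)).mul_right _
  induction f using Polynomial.induction_on with
  | C a => simp
  | add p q hp hq =>
    convert dvd_add hp hq using 1
    simp only [map_add, add_mul, mul_add]
    abel
  | monomial n a ih =>
    have e : (C a * X ^ (n + 1) : (Subalgebra.center F A)[X]) = C a * X ^ n * X := by
      rw [pow_succ, mul_assoc]
    rw [e]
    exact hstep _ ih

/-- The residue field of the center. -/
def residueCenter (H : IsFormalDeformation h π.toRingHom) : IntermediateField F A₀ :=
  ((Subalgebra.center F A).map π).toIntermediateField <| by
    rintro _ ⟨c, hc, rfl⟩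
    by_cases h0 : π c = 0
    · exact ⟨0, Subalgebra.zero_mem _, by simp [h0]⟩
    obtain ⟨u, rfl⟩ := H.isUnit_of_map_ne_zero h0
    refine ⟨↑u⁻¹, ?_, ?_⟩
    · have hc := Subalgebra.mem_center_iff.1 hc
      refine Subalgebra.mem_center_iff.2 ?_
      exact fun b => (Commute.units_inv_right (hc b)).eq
    · refine eq_inv_of_mul_eq_one_left ?_
      change π _ * π _ = 1
      rw [← map_mul, Units.inv_mul, map_one]

theorem mem_residueCenter (H : IsFormalDeformation h π.toRingHom) {x : A₀} :
    x ∈ H.residueCenter ↔ ∃ c ∈ Subalgebra.center F A, π c = x := Iff.rfl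

open Polynomial in
theorem map_aeval (f : (Subalgebra.center F A)[X]) (x : A) :
    π (aeval x f) = (f.map (π.toRingHom.comp (Subalgebra.center F A).val.toRingHom)).eval (π x) := by
  rw [aeval_def, eval_map, ← AlgHom.coe_toRingHom π, hom_eval₂]
  rfl

-- Newton iteration: each step solves the linearized equation in the field `A₀`, where the
-- derivative is invertible.
open Polynomial in
theorem exists_root (H : IsFormalDeformation h π.toRingHom) (f : (Subalgebra.center F A)[X])
    (x : A) (hx : π (aeval x f) = 0) (hx' : π (aeval x (derivative f)) ≠ 0) :
    ∃ y, π y = π x ∧ aeval y f = 0 := by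
  have step : ∀ (k : ℕ) (z : A), π z = π x → h ^ (k + 1) ∣ aeval z f →
      ∃ y, h ^ (k + 2) ∣ aeval (z + h ^ (k + 1) * y) f := by
    rintro k z hz ⟨w, hw⟩
    obtain ⟨y, hy⟩ := H.surj (- π w / π (aeval z (derivative f)))
    have hne : π (aeval z (derivative f)) ≠ 0 := by rwa [map_aeval, hz, ← map_aeval]
    refine ⟨y, ?_⟩
    have h1 := H.pow_dvd_aeval_add_sub f z y (k := k + 1) (by omega)
    have h2 : h ∣ w + aeval z (derivative f) * y := by
      rw [← H.map_eq_zero_iff]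
      change π _ = 0
      have hy : π y = _ := hy
      rw [map_add, map_mul, hy]
      field_simp
      ring
    have h3 : h ^ (k + 2) ∣ h ^ (k + 1) * (w + aeval z (derivative f) * y) := by
      rw [pow_succ _ (k + 1)]; exact mul_dvd_mul_left _ h2
    convert dvd_add h1 h3 using 1
    rw [hw]
    noncomm_ring
  choose! Y hY using step
  let S : ℕ → A := fun n => Nat.rec x (fun k z => z + h ^ (k + 1) * Y k z) n
  have hS : ∀ n, S (n + 1) = S n + h ^ (n + 1) * Y n (S n) := fun n => rfl
  have hprop : ∀ n, π (S n) = π x ∧ h ^ (n + 1) ∣ aeval (S n) f := by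
    intro n
    induction n with
    | zero => exact ⟨rfl, by rw [zero_add, pow_one]; exact (H.map_eq_zero_iff _).1 hx⟩
    | succ n ih =>
      rw [hS]
      refine ⟨?_, hY n _ ih.1 ih.2⟩
      have : π h = 0 := H.map_self
      simp [ih.1, this]
  -- The term `k = 0` is the starting point `x`, so the sum of the first `n + 1` terms is `S n`.
  obtain ⟨s, hs⟩ := H.complete fun k => if k = 0 then x else Y (k - 1) (S (k - 1))
  have hsum : ∀ n, ∑ k ∈ Finset.range (n + 1),
      h ^ k * (if k = 0 then x else Y (k - 1) (S (k - 1))) = S n := by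
    intro n
    induction n with
    | zero => simp [S]
    | succ n ih => rw [Finset.sum_range_succ, ih, hS]; simp
  refine ⟨s, ?_, H.separated _ fun n => ?_⟩
  · have h1 := hs 1
    rw [hsum 0, pow_one, ← H.map_eq_zero_iff] at h1
    have h1 : π (s - x) = 0 := h1
    rwa [map_sub, sub_eq_zero] at h1
  · obtain ⟨t, ht⟩ := hs (n + 1)
    rw [hsum n, sub_eq_iff_eq_add'] at ht
    have h1 := H.pow_dvd_aeval_add_sub f (S n) t (k := n + 1) (by omega)
    rw [← ht] at h1
    have h2 : h ^ (n + 1) ∣ h ^ (n + 1) * (aeval (S n) (derivative f) * t) := dvd_mul_right _ _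
    have h3 := dvd_add (dvd_add ((pow_dvd_pow h (by omega)).trans h1) h2) (hprop n).2
    have h4 := (pow_dvd_pow h (show n ≤ n + 1 by omega)).trans h3
    convert h4 using 1
    abel

-- If the roots differed by `h ^ k` times a unit, the Taylor expansion would make `h` divide the
-- derivative times that unit.
open Polynomial in
theorem root_unique (H : IsFormalDeformation h π.toRingHom) (f : (Subalgebra.center F A)[X])
    {x y : A} (hxy : π y = π x) (hx : aeval x f = 0) (hy : aeval y f = 0)
    (hx' : π (aeval x (derivative f)) ≠ 0) : y = x := by
  by_contra hne
  obtain ⟨k, u, hu⟩ := H.exists_eq_pow_mul_unit (sub_ne_zero.2 hne)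
  have hu0 : π (u : A) ≠ 0 := (u.isUnit.map π).ne_zero
  have hk : 1 ≤ k := by
    by_contra! h0
    obtain rfl : k = 0 := by omega
    apply hu0
    rw [pow_zero, one_mul] at hu
    rw [← hu, map_sub, hxy, sub_self]
  have h1 := H.pow_dvd_aeval_add_sub f x u hk
  rw [← hu, add_sub_cancel, hx, hy, sub_self, zero_sub, dvd_neg] at h1
  have h2 := (H.map_eq_zero_iff _).2 (H.dvd_of_pow_succ_dvd h1)
  have h2 : π _ = 0 := h2
  rw [map_mul] at h2
  exact (mul_ne_zero hx' hu0) h2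

open Polynomial in
/-- The Hensel lift of an element separable over the residue field of the center is fixed by all
inner automorphisms, hence central. -/
theorem mem_residueCenter_of_isSeparable (H : IsFormalDeformation h π.toRingHom) {x₀ : A₀}
    (hx₀ : IsSeparable H.residueCenter x₀) : x₀ ∈ H.residueCenter := by
  obtain ⟨f, hf⟩ : ∃ f : (Subalgebra.center F A)[X],
      f.map (π.toRingHom.comp (Subalgebra.center F A).val.toRingHom) =
        (minpoly H.residueCenter x₀).map (algebraMap _ A₀) := by
    rw [← Polynomial.mem_lifts, Polynomial.lifts_iff_coeff_lifts]
    intro n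
    rw [coeff_map]
    obtain ⟨c, hc, e⟩ := H.mem_residueCenter.1 ((minpoly H.residueCenter x₀).coeff n).2
    exact ⟨⟨c, hc⟩, e⟩
  obtain ⟨x, hx⟩ := H.surj x₀
  have hx : π x = x₀ := hx
  have hd : ∀ y, π y = x₀ → π (aeval y (derivative f)) ≠ 0 := by
    intro y hy
    rw [map_aeval, ← derivative_map, hf, hy, derivative_map, eval_map_algebraMap]
    exact hx₀.aeval_derivative_ne_zero (minpoly.aeval _ _)
  obtain ⟨y, hy, hyf⟩ := H.exists_root f x
    (by rw [map_aeval, hf, hx, eval_map_algebraMap, minpoly.aeval]) (hd x hx)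
  rw [hx] at hy
  have hunit : ∀ u : Aˣ, (u : A) * y = y * u := by
    intro u
    have hconj : aeval (↑u * y * ↑u⁻¹) f = ↑u * aeval y f * ↑u⁻¹ := by
      rw [aeval_eq_sum_range, aeval_eq_sum_range, Finset.mul_sum, Finset.sum_mul]
      simp only [← Units.conj_pow, mul_smul_comm, smul_mul_assoc]
    have hmap : π (↑u * y * ↑u⁻¹) = π y := by
      rw [map_mul, map_mul, mul_comm (π _) (π y), mul_assoc, ← map_mul, Units.mul_inv, map_one,
        mul_one]
    have := H.root_unique f hmap hyf (by rw [hconj, hyf]; simp) (hd y hy)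
    exact (Units.mul_inv_eq_iff_eq_mul _).1 this
  refine H.mem_residueCenter.2 ⟨y, ?_, hy⟩
  rw [Subalgebra.mem_center_iff]
  intro b
  by_cases hb : b = 0
  · simp [hb]
  obtain ⟨k, u, rfl⟩ := H.exists_eq_pow_mul_unit hb
  rw [mul_assoc, hunit, ← mul_assoc, ← mul_assoc, H.pow_comm]

end Algebra

end IsFormalDeformation

/-! ### Capelli polynomials -/

section Capelli

/-- The `n`-th Capelli polynomial `∑ sgn(σ) x_{σ 0} y₀ x_{σ 1} y₁ ⋯ x_{σ (n-1)} y_{n-1}`, as an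
alternating function of the `x`'s. -/
noncomputable def capelli (F : Type*) {R : Type*} [Field F] [Ring R] [Algebra F R] :
    (n : ℕ) → (y : ℕ → R) → R [⋀^Fin n]→ₗ[F] R
  | 0, _ => AlternatingMap.constOfIsEmpty F R (Fin 0) 1
  | n + 1, y => AlternatingMap.alternatizeUncurryFin
      { toFun := fun x => (LinearMap.mulLeft F (x * y 0)).compAlternatingMap
          (capelli F n fun k => y (k + 1))
        map_add' := fun a b => by ext; simp [add_mul, mul_assoc]
        map_smul' := fun c a => by ext; simp [mul_assoc] }

variable {F R : Type*} [Field F] [Ring R] [Algebra F R]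

theorem capelli_succ (n : ℕ) (y : ℕ → R) (x : Fin (n + 1) → R) :
    capelli F (n + 1) y x = ∑ i : Fin (n + 1),
      (-1) ^ (i : ℕ) • (x i * y 0 * capelli F n (fun k => y (k + 1)) (i.removeNth x)) := by
  rw [capelli, AlternatingMap.alternatizeUncurryFin_apply]
  rfl

theorem capelli_map {S : Type*} [Ring S] [Algebra F S] (φ : R →ₐ[F] S) (n : ℕ) (y : ℕ → R)
    (x : Fin n → R) :
    φ (capelli F n y x) = capelli F n (fun k => φ (y k)) (fun i => φ (x i)) := by
  induction n generalizing y with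
  | zero => simp [capelli]
  | succ n ih =>
    simp only [capelli_succ, map_sum, map_mul, map_zsmul, ih]
    rfl

/-- The Capelli polynomial in the free algebra, with `x`'s and `y`'s interleaved. -/
noncomputable def capelliFree (F : Type*) [Field F] (n : ℕ) : FreeAlgebra F ℕ :=
  capelli F n (fun k => FreeAlgebra.ι F (2 * k + 1)) (fun i => FreeAlgebra.ι F (2 * (i : ℕ)))

theorem lift_capelliFree (n : ℕ) (a : ℕ → R) :
    FreeAlgebra.lift F a (capelliFree F n) =
      capelli F n (fun k => a (2 * k + 1)) (fun i => a (2 * (i : ℕ))) := by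
  simp [capelliFree, capelli_map]

theorem isPolynomialIdentity_capelliFree_iff (n : ℕ) :
    IsPolynomialIdentity F R (capelliFree F n) ↔
      ∀ (y : ℕ → R) (x : Fin n → R), capelli F n y x = 0 := by
  refine ⟨fun H y x => ?_, fun H a => by rw [lift_capelliFree, H]⟩
  -- Even slots carry `x` and odd slots carry `y`; the default `0` is never read.
  have := H fun m => if Even m then (if hm : m / 2 < n then x ⟨m / 2, hm⟩ else 0) else y (m / 2)
  rw [lift_capelliFree] at this
  convert this using 3 with k i
  · funext k
    have h1 : ¬ Even (2 * k + 1) := by simp [parity_simps]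
    have h2 : (2 * k + 1) / 2 = k := by omega
    simp [h1, h2]
  · simp

theorem isPolynomialIdentity_matrix_capelliFree (d : ℕ) {n : ℕ} (hn : d ^ 2 < n) :
    IsPolynomialIdentity F (Matrix (Fin d) (Fin d) F) (capelliFree F n) := by
  rw [isPolynomialIdentity_capelliFree_iff]
  intro y x
  refine AlternatingMap.map_linearDependent _ _ fun hx => ?_
  have := hx.fintype_card_le_finrank
  simp [Module.finrank_matrix] at this
  nlinarith

/-- Expanding along the first `x`-slot, with `y 0` free, gives a relation `∑ xᵢ z wᵢ = 0` whose `wᵢ`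
are signed smaller Capelli values; `hR` would kill them all, including the one nonzero by induction.
-/
theorem capelli_ne_zero_of_linearIndependent [NeZero (1 : R)]
    (hR : ∀ (n : ℕ) (x : Fin n → R), LinearIndependent (Subalgebra.center F R) x →
      ∀ w : Fin n → R, (∀ y, ∑ i, x i * y * w i = 0) → ∀ i, w i = 0)
    (n : ℕ) (x : Fin n → R) (hx : LinearIndependent (Subalgebra.center F R) x) :
    ∃ y, capelli F n y x ≠ 0 := by
  induction n with
  | zero => exact ⟨0, by simp [capelli]⟩
  | succ n ih =>
    obtain ⟨y, hy⟩ := ih ((0 : Fin (n + 1)).removeNth x)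
      (hx.comp _ (Fin.succAbove_right_injective))
    by_contra! H
    apply hy
    have := hR (n + 1) x hx (fun i => (-1) ^ (i : ℕ) • capelli F n y (i.removeNth x)) ?_ 0
    · simpa using this
    · intro z
      have := H fun k => Nat.casesOn k z y
      rw [capelli_succ] at this
      simp only [mul_smul_comm]
      exact this

end Capelli

/-! ### Upper bound on the residue degree -/

namespace IsFormalDeformation

variable {F A A₀ : Type*} [Field F] [Ring A] [Algebra F A] [Field A₀] [Algebra F A₀]
  {h : A} {π : A →ₐ[F] A₀}

/-- If `∑ xᵢ y wᵢ = 0` for all `y`, where the `xᵢ` are linearly independent over the center, then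
all `wᵢ` vanish. -/
theorem eq_zero_of_sum_mul_mul_eq_zero (H : IsFormalDeformation h π.toRingHom) {ι : Type*}
    {x : ι → A} (hx : LinearIndependent (Subalgebra.center F A) x) (s : Finset ι) (w : ι → A)
    (hw : ∀ y, ∑ i ∈ s, x i * y * w i = 0) : ∀ i ∈ s, w i = 0 := by
  classical
  induction s using Finset.induction_on generalizing w with
  | empty => simp
  | insert i s hi ih =>
    -- Multiplying the relation at `y` by `z * w i` and subtracting the relation at `y * w i * z`
    -- cancels the term of index `i`.
    have hrel : ∀ z, ∀ j ∈ s, w j * z * w i - w i * z * w j = 0 := by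
      intro z
      refine ih (fun j => w j * z * w i - w i * z * w j) fun y => ?_
      have h1 := congrArg (· * (z * w i)) (hw y)
      have h2 := hw (y * w i * z)
      simp only [Finset.sum_insert hi, add_mul, Finset.sum_mul, zero_mul] at h1 h2
      rw [← sub_eq_zero.2 (h1.trans h2.symm)]
      simp only [mul_sub, Finset.sum_sub_distrib, mul_assoc]
      abel
    by_cases hwi : w i = 0
    · intro j hj
      rcases Finset.mem_insert.1 hj with rfl | hj
      · exact hwi
      · refine ih w (fun y => ?_) j hj
        have := hw y
        rwa [Finset.sum_insert hi, hwi, mul_zero, zero_add] at this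
    exfalso
    obtain ⟨k, v, hv1, hv2⟩ := H.exists_mul_eq_pow hwi
    have hrel' : ∀ z, ∀ j ∈ insert i s, w j * z * w i = w i * z * w j := by
      intro z j hj
      rcases Finset.mem_insert.1 hj with rfl | hj
      · rfl
      · exact sub_eq_zero.1 (hrel z j hj)
    -- Here `v` is an inverse of `w i` up to `h ^ k`; sandwiching `hrel'` between two copies of `v`
    -- shows that each `w j * v` is central.
    have key : ∀ j ∈ insert i s, ∀ z, v * w j * z = z * w j * v := by
      intro j hj z
      refine sub_eq_zero.1 (H.pow_regular k ?_)
      rw [mul_sub, sub_eq_zero]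
      calc h ^ k * (v * w j * z) = v * w j * z * (w i * v) := by rw [H.pow_comm, hv2]
        _ = v * (w j * z * w i) * v := by simp only [mul_assoc]
        _ = v * (w i * z * w j) * v := by rw [hrel' z j hj]
        _ = (v * w i) * (z * w j * v) := by simp only [mul_assoc]
        _ = h ^ k * (z * w j * v) := by rw [hv1]
    have hc : ∀ j ∈ insert i s, w j * v ∈ Subalgebra.center F A := by
      intro j hj
      rw [Subalgebra.mem_center_iff]
      intro b
      have h1 := key j hj 1
      have h2 := key j hj b
      rw [mul_one, one_mul] at h1
      rw [h1] at h2
      rw [h2, mul_assoc]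
    let c : ι → Subalgebra.center F A := fun j =>
      if hj : j ∈ insert i s then ⟨w j * v, hc j hj⟩ else 0
    have h0 := linearIndependent_iff'.1 hx (insert i s) c ?_ i (Finset.mem_insert_self i s)
    · have h1 : w i * v = 0 := by
        have := congrArg Subtype.val h0
        simpa [c] using this
      -- The relation at `y = v` is a central dependence among the `x j`, forcing `w i * v = h ^ k`
      -- to vanish.
      exact H.pow_ne_zero k (hv2.symm.trans h1)
    · rw [← hw v]
      refine Finset.sum_congr rfl fun j hj => ?_
      have h1 := key j hj 1
      rw [mul_one, one_mul] at h1
      have h2 : (c j : A) = w j * v := by simp only [c, dif_pos hj]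
      rw [Subalgebra.smul_def, h2, smul_eq_mul, ← Subalgebra.mem_center_iff.1 (hc j hj), ← h1,
        mul_assoc]

/-- Reducing a relation over the center makes all coefficients divisible by `h`. The quotients are
again central, so one divides forever and separatedness gives zero. -/
theorem linearIndependent_of_map (H : IsFormalDeformation h π.toRingHom) {ι : Type*} (x : ι → A)
    (hx : LinearIndependent H.residueCenter fun i => π (x i)) :
    LinearIndependent (Subalgebra.center F A) x := by
  classical
  rw [linearIndependent_iff']
  intro s g hg
  have hdvd : ∀ n, ∀ i ∈ s, h ^ n ∣ (g i : A) := by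
    intro n
    induction n with
    | zero => simp
    | succ n ih =>
      choose! c hc using ih
      have hcen : ∀ i ∈ s, c i ∈ Subalgebra.center F A := by
        intro i hi
        rw [Subalgebra.mem_center_iff]
        intro b
        refine sub_eq_zero.1 (H.pow_regular n ?_)
        rw [mul_sub, sub_eq_zero, ← mul_assoc, ← mul_assoc, ← hc i hi, H.pow_comm, mul_assoc,
          ← hc i hi]
        exact Subalgebra.mem_center_iff.1 (g i).2 b
      have hsum : ∑ i ∈ s, c i * x i = 0 := by
        refine H.pow_regular n ?_
        rw [Finset.mul_sum, ← hg]
        refine Finset.sum_congr rfl fun i hi => ?_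
        rw [← mul_assoc, ← hc i hi, Subalgebra.smul_def, smul_eq_mul]
      intro i hi
      let c' : ι → H.residueCenter := fun j =>
        if hj : j ∈ s then ⟨π (c j), H.mem_residueCenter.2 ⟨_, hcen j hj, rfl⟩⟩ else 0
      have h0 := linearIndependent_iff'.1 hx s c' ?_ i hi
      · have h1 : π (c i) = 0 := by
          have := congrArg Subtype.val h0
          simpa [c', hi] using this
        rw [hc i hi, pow_succ]
        exact mul_dvd_mul_left _ ((H.map_eq_zero_iff _).1 h1)
      · rw [← map_zero π, ← hsum, map_sum]
        refine Finset.sum_congr rfl fun j hj => ?_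
        rw [map_mul]
        simp only [c', dif_pos hj]
        rfl
  exact fun i hi => Subtype.ext (H.separated _ fun n => hdvd n i hi)

theorem card_le_of_satisfiesMatrixIdentities (H : IsFormalDeformation h π.toRingHom) {d : ℕ}
    (hd : SatisfiesMatrixIdentities F A d) {n : ℕ} (x : Fin n → A₀)
    (hx : LinearIndependent H.residueCenter x) : n ≤ d ^ 2 := by
  by_contra! hn
  have h1 := (isPolynomialIdentity_capelliFree_iff n).1
    (hd _ (isPolynomialIdentity_matrix_capelliFree d hn))
  choose a ha using fun i => H.surj (x i)
  have ha : ∀ i, π (a i) = x i := ha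
  have := H.nontrivial
  obtain ⟨y, hy⟩ := capelli_ne_zero_of_linearIndependent
    (fun n x hx w hw i => H.eq_zero_of_sum_mul_mul_eq_zero hx Finset.univ w hw i
      (Finset.mem_univ i)) n a (H.linearIndependent_of_map a (by simpa only [ha] using hx))
  exact hy (h1 y a)

theorem finite_residueCenter (H : IsFormalDeformation h π.toRingHom) {d : ℕ}
    (hd : SatisfiesMatrixIdentities F A d) :
    FiniteDimensional H.residueCenter A₀ ∧ Module.finrank H.residueCenter A₀ ≤ d ^ 2 := by
  have hr : Module.rank H.residueCenter A₀ ≤ (d ^ 2 : ℕ) := by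
    refine rank_le fun s hs => ?_
    have := H.card_le_of_satisfiesMatrixIdentities hd _
      (hs.comp s.equivFin.symm s.equivFin.symm.injective)
    exact this
  refine ⟨?_, Module.finrank_le_of_rank_le hr⟩
  rw [FiniteDimensional, ← Module.rank_lt_aleph0_iff]
  exact hr.trans_lt (Cardinal.natCast_lt_aleph0)

end IsFormalDeformation

/-! ### Matrix identities under field extension -/

section MatrixIdentities

theorem IsPolynomialIdentity.of_injective {F R S : Type*} [Field F] [Ring R] [Algebra F R]
    [Ring S] [Algebra F S] {f : FreeAlgebra F ℕ} (hf : IsPolynomialIdentity F S f)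
    (φ : R →ₐ[F] S) (hφ : Function.Injective φ) : IsPolynomialIdentity F R f := by
  intro a
  apply hφ
  rw [map_zero, ← hf fun k => φ (a k), ← AlgHom.comp_apply]
  congr 1
  ext; simp

/-- The generic `n × n` matrices. -/
noncomputable def genericMatrix (F : Type*) [Field F] (n k : ℕ) :
    Matrix (Fin n) (Fin n) (MvPolynomial (ℕ × Fin n × Fin n) F) :=
  Matrix.of fun i j => MvPolynomial.X (k, i, j)

theorem lift_eq_map_genericMatrix {F L : Type*} [Field F] [Field L] [Algebra F L] {n : ℕ}
    (f : FreeAlgebra F ℕ) (a : ℕ → Matrix (Fin n) (Fin n) L) :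
    FreeAlgebra.lift F a f = (FreeAlgebra.lift F (genericMatrix F n) f).map
      (MvPolynomial.aeval fun p : ℕ × Fin n × Fin n => a p.1 p.2.1 p.2.2) := by
  have : FreeAlgebra.lift F a = (AlgHom.mapMatrix
      (MvPolynomial.aeval fun p : ℕ × Fin n × Fin n => a p.1 p.2.1 p.2.2)).comp
      (FreeAlgebra.lift F (genericMatrix F n)) := by
    ext k i j
    simp [genericMatrix]
  rw [this]
  rfl

/-- Over an infinite field, the identities of `n × n` matrices persist under extension of the
field. -/
theorem IsPolynomialIdentity.matrix_baseChange {F K : Type*} [Field F] [Infinite F] [Field K]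
    [Algebra F K] {n : ℕ} {f : FreeAlgebra F ℕ}
    (hf : IsPolynomialIdentity F (Matrix (Fin n) (Fin n) F) f) :
    IsPolynomialIdentity F (Matrix (Fin n) (Fin n) K) f := by
  have hG : FreeAlgebra.lift F (genericMatrix F n) f = 0 := by
    ext1 i j
    refine MvPolynomial.funext fun p => ?_
    have h1 := hf fun k => Matrix.of fun i j => p (k, i, j)
    rw [lift_eq_map_genericMatrix] at h1
    have h2 := congrFun (congrFun h1 i) j
    rw [Matrix.map_apply] at h2
    rw [Matrix.zero_apply, map_zero, ← MvPolynomial.coe_aeval_eq_eval]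
    exact h2
  intro a
  rw [lift_eq_map_genericMatrix, hG, Matrix.map_zero _ (map_zero _)]

end MatrixIdentities
open scoped TensorProduct

/-! ### Embedding into matrices and the lower bound -/

section Splitting

/-- A nonzero finite-dimensional algebra over an algebraically closed field has a quotient which
is a full matrix algebra. -/
theorem exists_algHom_matrix_surjective (K B : Type*) [Field K] [IsAlgClosed K] [Ring B]
    [Nontrivial B] [Algebra K B] [FiniteDimensional K B] :
    ∃ (n : ℕ) (_ : NeZero n) (φ : B →ₐ[K] Matrix (Fin n) (Fin n) K), Function.Surjective φ := by
  have : IsNoetherianRing B := isNoetherian_of_tower K inferInstance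
  -- A maximal proper two-sided ideal has a simple quotient.
  obtain ⟨J, ⟨hJ, hJ1⟩, hmax⟩ := set_has_maximal_iff_noetherian.2 this
    {I : Ideal B | I.IsTwoSided ∧ I ≠ ⊤} ⟨⊥, inferInstance, bot_ne_top⟩
  have : IsSimpleRing (B ⧸ J) := by
    rw [isSimpleRing_iff_isTwoSided_imp]
    refine ⟨Ideal.Quotient.nontrivial_iff.2 hJ1, fun I hI => ?_⟩
    have hmem : J ≤ I.comap (Ideal.Quotient.mk J) := fun x hx => by
      rw [Ideal.mem_comap, Ideal.Quotient.eq_zero_iff_mem.2 hx]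
      exact I.zero_mem
    have hcomap : I = (I.comap (Ideal.Quotient.mk J)).map (Ideal.Quotient.mk J) :=
      (Ideal.map_comap_of_surjective _ Ideal.Quotient.mk_surjective I).symm
    by_cases ht : I.comap (Ideal.Quotient.mk J) = ⊤
    · right
      rw [hcomap, ht, Ideal.map_top]
    · left
      have h2 := hmax _ ⟨inferInstance, ht⟩
      have h3 : I.comap (Ideal.Quotient.mk J) = J := (eq_of_le_of_not_lt hmem h2).symm
      rw [hcomap, h3, Ideal.map_quotient_self]
  have : FiniteDimensional K (B ⧸ J) :=
    Module.Finite.of_surjective (Ideal.Quotient.mkₐ K J).toLinearMap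
      (Ideal.Quotient.mkₐ_surjective K J)
  obtain ⟨n, hn, ⟨e⟩⟩ := IsSimpleRing.exists_algEquiv_matrix_of_isAlgClosed K (B ⧸ J)
  exact ⟨n, hn, e.toAlgHom.comp (Ideal.Quotient.mkₐ K J),
    e.surjective.comp (Ideal.Quotient.mkₐ_surjective K J)⟩

end Splitting

namespace IsFormalDeformation

universe u

variable {F A₀ : Type*} {A : Type u} [Field F] [Ring A] [Algebra F A] [Field A₀] [Algebra F A₀]
  {h : A} {π : A →ₐ[F] A₀}

theorem isDomain_center (H : IsFormalDeformation h π.toRingHom) :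
    IsDomain (Subalgebra.center F A) := by
  have := H.nontrivial
  have : NoZeroDivisors A := ⟨H.eq_zero_or_eq_zero⟩
  have : IsDomain A := NoZeroDivisors.to_isDomain A
  infer_instance

/-- Lifts of a generating family of the residue algebra over the residue field of the center
generate `A` over its center. -/
theorem span_range_eq_top (H : IsFormalDeformation h π.toRingHom) {r : ℕ} (x : Fin r → A)
    (hx : Submodule.span H.residueCenter (Set.range fun i => π (x i)) = ⊤) :
    Submodule.span (Subalgebra.center F A) (Set.range x) = ⊤ := by
  have step : ∀ a : A, ∃ (c : Fin r → Subalgebra.center F A) (b : A),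
      a = ∑ i, (c i : A) * x i + h * b := by
    intro a
    obtain ⟨z, hz⟩ := (Submodule.mem_span_range_iff_exists_fun H.residueCenter).1
      (hx ▸ Submodule.mem_top : π a ∈ Submodule.span H.residueCenter (Set.range fun i => π (x i)))
    choose c hc hcz using fun i => H.mem_residueCenter.1 (z i).2
    obtain ⟨b, hb⟩ := (H.map_eq_zero_iff (a - ∑ i, c i * x i)).1 (by
      change π _ = 0
      rw [map_sub, ← hz, map_sum, sub_eq_zero]
      refine Finset.sum_congr rfl fun i _ => ?_
      rw [map_mul, hcz]
      rfl)
    exact ⟨fun i => ⟨c i, hc i⟩, b, by rw [← hb]; simp⟩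
  choose c b hcb using step
  rw [eq_top_iff]
  intro a _
  -- Iterating `step` produces coefficient series in `h`; their limits are central because all
  -- partial sums are.
  have hlim : ∀ i, ∃ s ∈ Subalgebra.center F A, ∀ n,
      h ^ n ∣ s - ∑ k ∈ Finset.range n, h ^ k * (c (b^[k] a) i : A) := by
    intro i
    obtain ⟨s, hs⟩ := H.complete fun k => (c (b^[k] a) i : A)
    refine ⟨s, Subalgebra.mem_center_iff.2 fun y => ?_, hs⟩
    refine sub_eq_zero.1 (H.separated _ fun n => ?_)
    have hcomm : y * (∑ k ∈ Finset.range n, h ^ k * (c (b^[k] a) i : A)) =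
        (∑ k ∈ Finset.range n, h ^ k * (c (b^[k] a) i : A)) * y := by
      rw [Finset.mul_sum, Finset.sum_mul]
      refine Finset.sum_congr rfl fun k _ => ?_
      rw [← mul_assoc, ← H.pow_comm, mul_assoc, mul_assoc,
        Subalgebra.mem_center_iff.1 (c (b^[k] a) i).2]
    have := dvd_sub (H.dvd_mul_left y (hs n)) ((hs n).mul_right y)
    rwa [mul_sub, sub_mul, hcomm, sub_sub_sub_cancel_right] at this
  choose s hs hsn using hlim
  have hexp : ∀ n, a = ∑ k ∈ Finset.range n, h ^ k * ∑ i, (c (b^[k] a) i : A) * x i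
      + h ^ n * b^[n] a := by
    intro n
    induction n with
    | zero => simp
    | succ n ih =>
      conv_lhs => rw [ih, hcb (b^[n] a)]
      rw [Finset.sum_range_succ, mul_add, Function.iterate_succ_apply', pow_succ]
      simp only [mul_assoc, add_assoc]
  have ha : a = ∑ i, s i * x i := by
    refine sub_eq_zero.1 (H.separated _ fun n => ?_)
    have h1 : ∑ k ∈ Finset.range n, h ^ k * ∑ i, (c (b^[k] a) i : A) * x i =
        ∑ i, (∑ k ∈ Finset.range n, h ^ k * (c (b^[k] a) i : A)) * x i := by
      simp only [Finset.mul_sum, Finset.sum_mul]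
      rw [Finset.sum_comm]
      simp only [mul_assoc]
    conv_rhs => rw [hexp n, h1, add_sub_right_comm, ← Finset.sum_sub_distrib]
    refine dvd_add (Finset.dvd_sum fun i _ => ?_) (dvd_mul_right _ _)
    rw [← sub_mul, ← dvd_neg, ← neg_mul, neg_sub]
    exact (hsn i n).mul_right _
  rw [ha]
  exact Submodule.sum_mem _ fun i _ => Submodule.smul_mem _ (⟨s i, hs i⟩ : Subalgebra.center F A)
    (Submodule.subset_span ⟨i, rfl⟩)

/-- `A` embeds into a matrix algebra whose dimension is at most the degree of the residue algebra
over the residue field of the center. -/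
theorem exists_injective_algHom_matrix (H : IsFormalDeformation h π.toRingHom)
    [FiniteDimensional H.residueCenter A₀] :
    ∃ (n : ℕ) (K : Type u) (_ : Field K) (_ : Algebra F K)
      (φ : A →ₐ[F] Matrix (Fin n) (Fin n) K), Function.Injective φ ∧
      n ^ 2 ≤ Module.finrank H.residueCenter A₀ := by
  have hdom := H.isDomain_center
  have := H.nontrivial
  have : NoZeroDivisors A := ⟨H.eq_zero_or_eq_zero⟩
  set r := Module.finrank H.residueCenter A₀ with hr
  let v := Module.finBasis H.residueCenter A₀
  choose x hx using fun i => H.surj (v i)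
  have hx : ∀ i, π (x i) = v i := hx
  have hspan := H.span_range_eq_top x (by simp only [hx]; exact v.span_eq)
  have hli := H.linearIndependent_of_map x (by simp only [hx]; exact v.linearIndependent)
  let β : Module.Basis (Fin r) (Subalgebra.center F A) A := Module.Basis.mk hli hspan.ge
  let K := AlgebraicClosure (FractionRing (Subalgebra.center F A))
  let βK : Module.Basis (Fin r) K (K ⊗[Subalgebra.center F A] A) := β.baseChange K
  have : Module.Free (Subalgebra.center F A) A := Module.Free.of_basis β
  have : Module.Finite K (K ⊗[Subalgebra.center F A] A) := Module.Finite.of_basis βK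
  have hrK : Module.finrank K (K ⊗[Subalgebra.center F A] A) = r := by
    rw [Module.finrank_eq_card_basis βK, Fintype.card_fin]
  have : Nontrivial (K ⊗[Subalgebra.center F A] A) := by
    refine Module.nontrivial_of_finrank_pos (R := K) ?_
    rw [hrK]
    exact Module.finrank_pos
  obtain ⟨n, hn, φ, hφ⟩ := exists_algHom_matrix_surjective K (K ⊗[Subalgebra.center F A] A)
  let ψ : A →ₐ[F] Matrix (Fin n) (Fin n) K := (φ.restrictScalars F).comp
    ((Algebra.TensorProduct.includeRight :
      A →ₐ[Subalgebra.center F A] K ⊗[Subalgebra.center F A] A).restrictScalars F)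
  refine ⟨n, K, inferInstance, inferInstance, ψ, ?_, ?_⟩
  -- A nonzero `a` divides some `h ^ k`, which is central and so maps to a nonzero scalar matrix.
  · rw [injective_iff_map_eq_zero]
    intro a ha
    by_contra ha0
    obtain ⟨k, w, hw, -⟩ := H.exists_mul_eq_pow ha0
    have h0 : ψ (h ^ k) = 0 := by rw [← hw, map_mul, ha, mul_zero]
    let c : Subalgebra.center F A :=
      ⟨h ^ k, Subalgebra.mem_center_iff.2 fun b => (H.pow_comm k b).symm⟩
    have hc : ψ (h ^ k) = algebraMap K _ (algebraMap (Subalgebra.center F A) K c) := by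
      rw [← φ.commutes, ← IsScalarTower.algebraMap_apply,
        ← (Algebra.TensorProduct.includeRight :
          A →ₐ[Subalgebra.center F A] K ⊗[Subalgebra.center F A] A).commutes]
      rfl
    have hcK : algebraMap (Subalgebra.center F A) K c = 0 :=
      (algebraMap K (Matrix (Fin n) (Fin n) K)).injective (by rw [← hc, h0, map_zero])
    rw [IsScalarTower.algebraMap_apply _ (FractionRing (Subalgebra.center F A)) K,
      map_eq_zero, FaithfulSMul.algebraMap_eq_zero_iff] at hcK
    exact H.pow_ne_zero k (congrArg Subtype.val hcK)
  · have := LinearMap.finrank_le_finrank_of_surjective (f := φ.toLinearMap) hφ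
    rw [hrK, Module.finrank_matrix] at this
    simpa [sq] using this

end IsFormalDeformation

/-! ### Quantum formal deformations as complete rings -/

namespace PowerSeries

theorem X_pow_smul_eq_mul {F A₀ : Type*} [Field F] [CommRing A₀] [Algebra F A₀] (n : ℕ)
    (g : A₀⟦X⟧) : ((X : F⟦X⟧) ^ n) • g = X ^ n * g := by
  rw [Algebra.smul_def, map_pow]
  congr 2
  exact map_X _

/-- Every series `∑ Xᵏ aₖ` of power series converges. -/
theorem exists_X_pow_dvd_sub_sum {R : Type*} [CommRing R] (a : ℕ → R⟦X⟧) :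
    ∃ s : R⟦X⟧, ∀ n, X ^ n ∣ s - ∑ k ∈ Finset.range n, X ^ k * a k := by
  -- The coefficient of `X ^ m` only depends on the terms with `k ≤ m`.
  refine ⟨mk fun m => coeff m (∑ k ∈ Finset.range (m + 1), X ^ k * a k), fun n => ?_⟩
  rw [X_pow_dvd_iff]
  intro m hm
  rw [map_sub, coeff_mk, sub_eq_zero, map_sum, map_sum]
  refine Finset.sum_subset (Finset.range_mono hm) fun k _ hk => ?_
  rw [Finset.mem_range] at hk
  rw [coeff_X_pow_mul', if_neg (by omega)]

end PowerSeries

section Reduction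

variable {F A₀ A : Type*} [Field F] [Field A₀] [Algebra F A₀]
    [Ring A] [Algebra F⟦X⟧ A] [Algebra F A] [IsScalarTower F F⟦X⟧ A]

/-- The reduction modulo `ħ` of a quantum formal deformation. -/
noncomputable def QuantumFormalDeformation.reduction (D : QuantumFormalDeformation F A₀ A) :
    A →ₐ[F] A₀ :=
  D.reductionIso.toAlgHom.comp (Ideal.Quotient.mkₐ F (hbarIdeal F A))

theorem QuantumFormalDeformation.isFormalDeformation (D : QuantumFormalDeformation F A₀ A) :
    IsFormalDeformation (algebraMap F⟦X⟧ A PowerSeries.X) D.reduction.toRingHom := by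
  obtain ⟨e⟩ := D.moduleIso
  have hpow : ∀ (n : ℕ) (a : A),
      e (algebraMap F⟦X⟧ A PowerSeries.X ^ n * a) = PowerSeries.X ^ n * e a := by
    intro n a
    rw [← map_pow, ← Algebra.smul_def, map_smul, PowerSeries.X_pow_smul_eq_mul]
  have hdvd : ∀ (n : ℕ) (a : A),
      algebraMap F⟦X⟧ A PowerSeries.X ^ n ∣ a ↔ PowerSeries.X ^ n ∣ e a := by
    intro n a
    constructor
    · rintro ⟨b, rfl⟩
      rw [hpow]
      exact dvd_mul_right _ _
    · rintro ⟨g, hg⟩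
      refine ⟨e.symm g, e.injective ?_⟩
      rw [hpow, hg, e.apply_symm_apply]
  refine ⟨fun a => Algebra.commutes _ _,
    D.reductionIso.surjective.comp (Ideal.Quotient.mkₐ_surjective F (hbarIdeal F A)),
    fun a => ?_, fun a ha => ?_, fun a ha => ?_, fun a => ?_⟩
  · change D.reductionIso (Ideal.Quotient.mk (hbarIdeal F A) a) = 0 ↔ _
    rw [EmbeddingLike.map_eq_zero_iff, Ideal.Quotient.eq_zero_iff_mem, hbarIdeal,
      Ideal.mem_span_singleton']
    exact ⟨fun ⟨c, hc⟩ => ⟨c, by rw [← hc, Algebra.commutes]⟩,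
      fun ⟨c, hc⟩ => ⟨c, by rw [hc, Algebra.commutes]⟩⟩
  · have := hpow 1 a
    rw [pow_one, ha, map_zero, pow_one, eq_comm, mul_eq_zero] at this
    exact e.map_eq_zero_iff.1 (this.resolve_left PowerSeries.X_ne_zero)
  · refine e.map_eq_zero_iff.1 (PowerSeries.ext fun n => ?_)
    exact PowerSeries.X_pow_dvd_iff.1 ((hdvd (n + 1) a).1 (ha (n + 1))) n n.lt_succ_self
  · obtain ⟨s, hs⟩ := PowerSeries.exists_X_pow_dvd_sub_sum fun k => e (a k)
    refine ⟨e.symm s, fun n => (hdvd n _).2 ?_⟩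
    simpa only [map_sub, map_sum, hpow, e.apply_symm_apply] using hs n

end Reduction

/-! ### Conclusion -/

/-- The square of the PI degree is the degree of the residue algebra over the residue field of the
center, which is purely inseparable. -/
theorem IsFormalDeformation.exists_sq_eq_pow {F A₀ A : Type*} [Field F] [IsAlgClosed F]
    [Field A₀] [Algebra F A₀] [Ring A] [Algebra F A] {h : A} {π : A →ₐ[F] A₀}
    (H : IsFormalDeformation h π.toRingHom) {d : ℕ} (hd : IsPIAlgebraOfDegree F A d) (q : ℕ)
    [ExpChar F q] : ∃ m : ℕ, d ^ 2 = q ^ m := by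
  obtain ⟨hfin, hle⟩ := H.finite_residueCenter hd.satisfies
  have : Infinite F := IsAlgClosed.instInfinite
  have : ExpChar H.residueCenter q := expChar_of_injective_algebraMap
    (algebraMap F H.residueCenter).injective q
  have : IsPurelyInseparable H.residueCenter A₀ := isPurelyInseparable_iff.2 fun x =>
    ⟨Algebra.IsIntegral.isIntegral x,
      fun hx => ⟨⟨x, H.mem_residueCenter_of_isSeparable hx⟩, rfl⟩⟩
  obtain ⟨m, hm⟩ := IsPurelyInseparable.finrank_eq_pow (F := H.residueCenter) A₀ q
  obtain ⟨n, K, _, _, φ, hφ, hn⟩ := H.exists_injective_algHom_matrix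
  have hdn : d ≤ n := by
    by_contra! hlt
    exact hd.not_smaller n hlt fun f hf => hf.matrix_baseChange.of_injective φ hφ
  exact ⟨m, by rw [← hm]; exact le_antisymm ((Nat.pow_le_pow_left hdn 2).trans hn) hle⟩

theorem SatisfiesMatrixIdentities.mul_comm {F A : Type*} [Field F] [Ring A] [Algebra F A]
    (hA : SatisfiesMatrixIdentities F A 1) (a b : A) : a * b = b * a := by
  have h1 : IsPolynomialIdentity F (Matrix (Fin 1) (Fin 1) F)
      (FreeAlgebra.ι F 0 * FreeAlgebra.ι F 1 - FreeAlgebra.ι F 1 * FreeAlgebra.ι F 0) := by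
    intro x
    ext i j
    simp [Matrix.mul_apply, Subsingleton.elim i 0, Subsingleton.elim j 0, _root_.mul_comm]
  have h2 := hA _ h1 fun k => if k = 0 then a else b
  simpa [sub_eq_zero] using h2

theorem theorem2p1 {F A₀ A : Type*} [Field F] [IsAlgClosed F] [Field A₀] [Algebra F A₀]
    [Ring A] [Algebra F⟦X⟧ A] [Algebra F A] [IsScalarTower F F⟦X⟧ A]
    (D : QuantumFormalDeformation F A₀ A) (d : ℕ) (hd : IsPIAlgebraOfDegree F A d) :
    (CharZero F → d = 1 ∧ ∀ a b : A, a * b = b * a) ∧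
    (∀ p : ℕ, p.Prime → CharP F p → ∃ k : ℕ, d = p ^ k) := by
  have H := D.isFormalDeformation
  refine ⟨fun _ => ?_, fun p hp _ => ?_⟩
  -- In characteristic zero the exponential characteristic is `1`, so `d ^ 2 = 1`.
  · obtain ⟨m, hm⟩ := H.exists_sq_eq_pow hd 1
    obtain rfl : d = 1 := by simpa using hm
    exact ⟨rfl, hd.satisfies.mul_comm⟩
  · have : ExpChar F p := .prime hp
    obtain ⟨m, hm⟩ := H.exists_sq_eq_pow hd p
    obtain ⟨k, -, hk⟩ := (Nat.dvd_prime_pow hp).1 (hm ▸ dvd_pow_self d two_ne_zero)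
    exact ⟨k, hk⟩
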